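/- Let $k$ be a commutative ring; $\otimes=\otimes_k$. All modules below are $k$-modules. A *monoidal Hom-algebra* $(A,\alpha)$ is a $k$-module $A$ with a $k$-linear automorphism $\alpha$, a bilinear product and an element $1\in A$ such that $\alpha(ab)=\alpha(a)\alpha(b)$, $\alpha(1)=1$, $\alpha(a)(bc)=(ab)\alpha(c)$ and $a1=1a=\alpha(a)$. A *monoidal Hom-coalgebra* $(C,\gamma)$ is a $k$-module $C$ with a $k$-linear automorphism $\gamma$ and linear maps $\Delta:C\to C\otimes C$, $\Delta(c)=c_{(1)}\otimes c_{(2)}$, and $\varepsilon:C\to k$ such that $\Delta(\gamma(c))=\gamma(c_{(1)})\otimes\gamma(c_{(2)})$, $\varepsilon(\gamma(c))=\varepsilon(c)$, $\gamma^{-1}(c_{(1)})\otimes c_{(2)(1)}\otimes c_{(2)(2)}=c_{(1)(1)}\otimes c_{(1)(2)}\otimes\gamma^{-1}(c_{(2)})$ and $\varepsilon(c_{(1)})c_{(2)}=\varepsilon(c_{(2)})c_{(1)}=\gamma^{-1}(c)$. A *monoidal Hom-Hopf algebra* $(H,\alpha)$ is a monoidal Hom-algebra and monoidal Hom-coalgebra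 with the same automorphism $\alpha$, such that $\Delta(ab)=a_{(1)}b_{(1)}\otimes a_{(2)}b_{(2)}$, $\Delta(1)=1\otimes1$, $\varepsilon(ab)=\varepsilon(a)\varepsilon(b)$, $\varepsilon(1)=1$, together with a linear map $S:H\to H$ (the antipode) such that $S\alpha=\alpha S$ and $S(h_{(1)})h_{(2)}=h_{(1)}S(h_{(2)})=\varepsilon(h)1$. A *left-right Hom-Yetter-Drinfeld module* over $(H,\alpha)$ is a $k$-module $M$ with a $k$-linear automorphism $\mu$, a bilinear action $H\times M\to M$, $(h,m)\mapsto h\cdot m$, and a linear coaction $\rho:M\to M\otimes H$, $\rho(m)=m_{[0]}\otimes m_{[1]}$, such that for all $g,h\in H$, $m\in M$: - $\mu(h\cdot m)=\alpha(h)\cdot\mu(m)$, $\ \alpha(g)\cdot(h\cdot m)=(gh)\cdot\mu(m)$, $\ 1\cdot m=\mu(m)$; - $\rho(\mu(m))=\mu(m_{[0]})\otimes\alpha(m_{[1]})$, $\ m_{[0][0]}\otimes(m_{[0][1]}\otimes\alpha^{-1}(m_{[1]}))=\mu^{-1}(m_{[0]})\otimes\Delta(m_{[1]})$, $\ m_{[0]}\varepsilon(m_{[1]})=\mu^{-1}(m)$;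 - $h_{(1)}\cdot m_{[0]}\otimes h_{(2)}m_{[1]}=\mu\big((h_{(2)}\cdot\mu^{-1}(m))_{[0]}\big)\otimes(h_{(2)}\cdot\mu^{-1}(m))_{[1]}h_{(1)}$. Morphisms are the $k$-linear maps that commute with the automorphisms $\mu$, the actions of $H$ and the coactions of $H$. **Corollary 4.5.** Let $(H,\alpha)$ be a monoidal Hom-Hopf algebra over $k$ with bijective antipode, and assume that $H$ is flat as a $k$-module (for example, that $k$ is a field). Then the category of left-right Hom-Yetter-Drinfeld modules over $(H,\alpha)$ is a Grothendieck category (an abelian category with exact filtered colimits and a generator) and has enough injective objects. -/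

import Mathlib

open CategoryTheory TensorProduct

universe u

/-- A monoidal Hom-algebra `(A, α)` over `k`: an algebra in the monoidal category of `k`-modules
equipped with an automorphism `α`. The product `ab` is `mul a b`. -/
structure MonoidalHomAlgebra (k A : Type u) [CommRing k] [AddCommGroup A] [Module k A] where
  /-- the structure automorphism `α` -/
  twist : A ≃ₗ[k] A
  mul : A →ₗ[k] A →ₗ[k] A
  one : A
  twist_mul : ∀ a b : A, twist (mul a b) = mul (twist a) (twist b)
  twist_one : twist one = one
  hom_assoc : ∀ a b c : A, mul (twist a) (mul b c) = mul (mul a b) (twist c)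
  mul_one : ∀ a : A, mul a one = twist a
  one_mul : ∀ a : A, mul one a = twist a

/-- A monoidal Hom-coalgebra `(C, γ)` over `k`. -/
structure MonoidalHomCoalgebra (k C : Type u) [CommRing k] [AddCommGroup C] [Module k C] where
  /-- the structure automorphism `γ` -/
  twist : C ≃ₗ[k] C
  comul : C →ₗ[k] C ⊗[k] C
  counit : C →ₗ[k] k
  /-- `Δ(γ(c)) = γ(c₁) ⊗ γ(c₂)` -/
  comul_twist : ∀ c : C,
    comul (twist c) = TensorProduct.map twist.toLinearMap twist.toLinearMap (comul c)
  counit_twist : ∀ c : C, counit (twist c) = counit c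
  /-- `γ⁻¹(c₁) ⊗ (c₂₁ ⊗ c₂₂) = c₁₁ ⊗ (c₁₂ ⊗ γ⁻¹(c₂))` -/
  hom_coassoc : ∀ c : C,
    TensorProduct.map twist.symm.toLinearMap comul (comul c) =
      TensorProduct.assoc k C C C
        (TensorProduct.map comul twist.symm.toLinearMap (comul c))
  /-- `ε(c₁) c₂ = γ⁻¹(c)` -/
  counit_comul : ∀ c : C, TensorProduct.lid k C (counit.rTensor C (comul c)) = twist.symm c
  /-- `ε(c₂) c₁ = γ⁻¹(c)` -/
  comul_counit : ∀ c : C, TensorProduct.rid k C (counit.lTensor C (comul c)) = twist.symm c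

/-- A monoidal Hom-bialgebra `(H, α)`: a monoidal Hom-algebra and a monoidal Hom-coalgebra with the
same structure automorphism, such that `Δ` and `ε` are morphisms of Hom-algebras. -/
structure MonoidalHomBialgebra (k H : Type u) [CommRing k] [AddCommGroup H] [Module k H] extends
    MonoidalHomAlgebra k H, MonoidalHomCoalgebra k H where
  /-- `Δ(ab) = a₁b₁ ⊗ a₂b₂` -/
  comul_mul : ∀ a b : H,
    comul (mul a b) =
      TensorProduct.map (TensorProduct.lift mul) (TensorProduct.lift mul)
        (TensorProduct.tensorTensorTensorComm k H H H H (comul a ⊗ₜ[k] comul b))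
  comul_one : comul one = one ⊗ₜ[k] one
  counit_mul : ∀ a b : H, counit (mul a b) = counit a * counit b
  counit_one : counit one = 1

/-- A monoidal Hom-Hopf algebra: a monoidal Hom-bialgebra with an antipode, i.e. a linear map `S`
commuting with `α` which is a two-sided convolution inverse of the identity. -/
structure MonoidalHomHopfAlgebra (k H : Type u) [CommRing k] [AddCommGroup H] [Module k H] extends
    MonoidalHomBialgebra k H where
  antipode : H →ₗ[k] H
  antipode_twist : ∀ h : H, antipode (twist h) = twist (antipode h)
  /-- `S(h₁) h₂ = ε(h) 1` -/
  antipode_mul_id : ∀ h : H,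
    TensorProduct.lift mul (antipode.rTensor H (comul h)) = counit h • one
  /-- `h₁ S(h₂) = ε(h) 1` -/
  id_mul_antipode : ∀ h : H,
    TensorProduct.lift mul (antipode.lTensor H (comul h)) = counit h • one

/-- A left Hom-module structure on `M` over a monoidal Hom-algebra `(A, α)`, with structure
automorphism `μ` of `M`. The action `a · m` is `act a m`. -/
structure LeftHomModule {k A : Type u} [CommRing k] [AddCommGroup A] [Module k A]
    (𝓐 : MonoidalHomAlgebra k A) (M : Type u) [AddCommGroup M] [Module k M] where
  /-- the structure automorphism `μ` -/
  twist : M ≃ₗ[k] M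
  act : A →ₗ[k] M →ₗ[k] M
  twist_act : ∀ (a : A) (m : M), twist (act a m) = act (𝓐.twist a) (twist m)
  act_act : ∀ (a b : A) (m : M), act (𝓐.twist a) (act b m) = act (𝓐.mul a b) (twist m)
  one_act : ∀ m : M, act 𝓐.one m = twist m

/-- A right Hom-comodule structure on `M` over a monoidal Hom-coalgebra `(C, γ)`, with structure
automorphism `μ` of `M`. The coaction `ρ(m) = m₀ ⊗ m₁` is `coact m`. -/
structure RightHomComodule {k C : Type u} [CommRing k] [AddCommGroup C] [Module k C]
    (𝓒 : MonoidalHomCoalgebra k C) (M : Type u) [AddCommGroup M] [Module k M] where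
  /-- the structure automorphism `μ` -/
  twist : M ≃ₗ[k] M
  coact : M →ₗ[k] M ⊗[k] C
  /-- `ρ(μ(m)) = μ(m₀) ⊗ γ(m₁)` -/
  coact_twist : ∀ m : M,
    coact (twist m) = TensorProduct.map twist.toLinearMap 𝓒.twist.toLinearMap (coact m)
  /-- `m₀₀ ⊗ (m₀₁ ⊗ γ⁻¹(m₁)) = μ⁻¹(m₀) ⊗ Δ(m₁)` -/
  coact_coact : ∀ m : M,
    TensorProduct.assoc k M C C
        (TensorProduct.map coact 𝓒.twist.symm.toLinearMap (coact m)) =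
      TensorProduct.map twist.symm.toLinearMap 𝓒.comul (coact m)
  /-- `m₀ ε(m₁) = μ⁻¹(m)` -/
  coact_counit : ∀ m : M,
    TensorProduct.rid k M (𝓒.counit.lTensor M (coact m)) = twist.symm m

/-- A left-right Hom-Yetter-Drinfeld structure on the `k`-module `M` over a monoidal Hom-Hopf
algebra `(H, α)`: a left Hom-module and a right Hom-comodule structure with the same structure
automorphism `μ`, satisfying the Yetter-Drinfeld compatibility. -/
structure HomYetterDrinfeldStructure {k H : Type u} [CommRing k] [AddCommGroup H] [Module k H]
    (𝓗 : MonoidalHomHopfAlgebra k H) (M : Type u) [AddCommGroup M] [Module k M] extends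
    LeftHomModule 𝓗.toMonoidalHomAlgebra M, RightHomComodule 𝓗.toMonoidalHomCoalgebra M where
  /-- `h₁ · m₀ ⊗ h₂ m₁ = μ((h₂ · μ⁻¹(m))₀) ⊗ (h₂ · μ⁻¹(m))₁ h₁`. On the right-hand side the maps
  are, from the innermost outwards, `h ↦ h₁ ⊗ h₂ ↦ h₂ ⊗ h₁ ↦ (h₂ · μ⁻¹(m)) ⊗ h₁`, then the coaction
  on the first factor, then `(m' ⊗ c) ⊗ h₁ ↦ m' ⊗ (c ⊗ h₁) ↦ μ(m') ⊗ c h₁`. -/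
  compat : ∀ (h : H) (m : M),
    TensorProduct.map (TensorProduct.lift act) (TensorProduct.lift 𝓗.mul)
        (TensorProduct.tensorTensorTensorComm k H H M H (𝓗.comul h ⊗ₜ[k] coact m)) =
      TensorProduct.map twist.toLinearMap (TensorProduct.lift 𝓗.mul)
        (TensorProduct.assoc k M H H
          (coact.rTensor H
            ((act.flip (twist.symm m)).rTensor H
              (TensorProduct.comm k H H (𝓗.comul h)))))

/-- The objects of the category of left-right Hom-Yetter-Drinfeld modules over `(H, α)`. -/
structure HomYetterDrinfeldModule {k H : Type u} [CommRing k] [AddCommGroup H] [Module k H]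
    (𝓗 : MonoidalHomHopfAlgebra k H) where
  carrier : Type u
  [addCommGroup : AddCommGroup carrier]
  [module : Module k carrier]
  str : HomYetterDrinfeldStructure 𝓗 carrier

namespace HomYetterDrinfeldModule

attribute [instance] HomYetterDrinfeldModule.addCommGroup HomYetterDrinfeldModule.module

section

variable {k H : Type u} [CommRing k] [AddCommGroup H] [Module k H]
  {𝓗 : MonoidalHomHopfAlgebra k H}

/-- Morphisms of Hom-Yetter-Drinfeld modules: `k`-linear maps commuting with the structure
automorphisms that are left `H`-linear and right `H`-colinear. -/
@[ext]
structure Hom (M N : HomYetterDrinfeldModule 𝓗) where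
  toLinearMap : M.carrier →ₗ[k] N.carrier
  map_twist : ∀ m : M.carrier, toLinearMap (M.str.twist m) = N.str.twist (toLinearMap m)
  map_act : ∀ (h : H) (m : M.carrier),
    toLinearMap (M.str.act h m) = N.str.act h (toLinearMap m)
  map_coact : ∀ m : M.carrier,
    N.str.coact (toLinearMap m) = toLinearMap.rTensor H (M.str.coact m)

/-- The category of left-right Hom-Yetter-Drinfeld modules over `(H, α)`. -/
instance : Category.{u} (HomYetterDrinfeldModule 𝓗) where
  Hom M N := Hom M N
  id M :=
    { toLinearMap := LinearMap.id
      map_twist := fun _ => rfl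
      map_act := fun _ _ => rfl
      map_coact := fun m => by simp }
  comp f g :=
    { toLinearMap := g.toLinearMap.comp f.toLinearMap
      map_twist := fun m => by simp [f.map_twist, g.map_twist]
      map_act := fun h m => by simp [f.map_act, g.map_act]
      map_coact := fun m => by
        simp [f.map_coact, g.map_coact, LinearMap.rTensor_comp] }

end

end HomYetterDrinfeldModule

/-! The forgetful functor to `k`-modules carries the whole argument. Colimits are computed on
underlying modules: tensoring with `H` is right exact and the axioms are linear in the module
element, so they pass to the colimit (`axiomsAt_map`, `axiomsAt_colimitData`). Flatness of `H` makes
`- ⊗ H` preserve injections and kernels, so kernels are computed on underlying modules too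
(`axiomsAt_of_injective`, `isStableRange_ker`). The forgetful functor also reflects isomorphisms, so
the coimage-image comparison is invertible and filtered colimits are exact because both hold for
`k`-modules.

For a generator, each element `x` lies in a subobject whose elements are the values at `x` of formal
terms built from the operations, the coaction entering through left tensor components
(`isStableRange_generatedSubmodule`). The type of terms depends only on `k` and `H`, so these
subobjects are represented, up to isomorphism, by structures on quotients of one type in universe
`u`. They form a small separating family, whose coproduct is a separator. Enough injectives is then
the general theorem on Grothendieck categories. -/

/-- The data of a Hom-Yetter-Drinfeld structure on `M`, without its axioms. -/
structure HomYetterDrinfeldData (k H M : Type u) [CommRing k] [AddCommGroup H] [Module k H]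
    [AddCommGroup M] [Module k M] where
  twist : M ≃ₗ[k] M
  act : H →ₗ[k] M →ₗ[k] M
  coact : M →ₗ[k] M ⊗[k] H

namespace HomYetterDrinfeldData

variable {k H M N : Type u} [CommRing k] [AddCommGroup H] [Module k H]
  [AddCommGroup M] [Module k M] [AddCommGroup N] [Module k N]

/-- The axioms of a Hom-Yetter-Drinfeld structure at a fixed element `m` of the module. -/
structure AxiomsAt (𝓗 : MonoidalHomHopfAlgebra k H) (D : HomYetterDrinfeldData k H M) (m : M) :
    Prop where
  twist_act : ∀ a : H, D.twist (D.act a m) = D.act (𝓗.twist a) (D.twist m)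
  act_act : ∀ a b : H, D.act (𝓗.twist a) (D.act b m) = D.act (𝓗.mul a b) (D.twist m)
  one_act : D.act 𝓗.one m = D.twist m
  coact_twist : D.coact (D.twist m) =
    TensorProduct.map D.twist.toLinearMap 𝓗.toMonoidalHomCoalgebra.twist.toLinearMap (D.coact m)
  coact_coact :
    TensorProduct.assoc k M H H
        (TensorProduct.map D.coact 𝓗.toMonoidalHomCoalgebra.twist.symm.toLinearMap (D.coact m)) =
      TensorProduct.map D.twist.symm.toLinearMap 𝓗.comul (D.coact m)
  coact_counit : TensorProduct.rid k M (𝓗.counit.lTensor M (D.coact m)) = D.twist.symm m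
  compat : ∀ h : H,
    TensorProduct.map (TensorProduct.lift D.act) (TensorProduct.lift 𝓗.mul)
        (TensorProduct.tensorTensorTensorComm k H H M H (𝓗.comul h ⊗ₜ[k] D.coact m)) =
      TensorProduct.map D.twist.toLinearMap (TensorProduct.lift 𝓗.mul)
        (TensorProduct.assoc k M H H
          (D.coact.rTensor H
            ((D.act.flip (D.twist.symm m)).rTensor H
              (TensorProduct.comm k H H (𝓗.comul h)))))

/-- Data satisfying the axioms at every element form a Hom-Yetter-Drinfeld structure. -/
def toStructure {𝓗 : MonoidalHomHopfAlgebra k H} (D : HomYetterDrinfeldData k H M)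
    (hD : ∀ m, D.AxiomsAt 𝓗 m) : HomYetterDrinfeldStructure 𝓗 M where
  twist := D.twist
  act := D.act
  coact := D.coact
  twist_act a m := (hD m).twist_act a
  act_act a b m := (hD m).act_act a b
  one_act m := (hD m).one_act
  coact_twist m := (hD m).coact_twist
  coact_coact m := (hD m).coact_coact
  coact_counit m := (hD m).coact_counit
  compat h m := (hD m).compat h

/-- The data underlying a Hom-Yetter-Drinfeld structure. -/
def ofStructure {𝓗 : MonoidalHomHopfAlgebra k H} (S : HomYetterDrinfeldStructure 𝓗 M) :
    HomYetterDrinfeldData k H M where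
  twist := S.twist
  act := S.act
  coact := S.coact

theorem axiomsAt_ofStructure {𝓗 : MonoidalHomHopfAlgebra k H}
    (S : HomYetterDrinfeldStructure 𝓗 M) (m : M) : (ofStructure S).AxiomsAt 𝓗 m where
  twist_act a := S.twist_act a m
  act_act a b := S.act_act a b m
  one_act := S.one_act m
  coact_twist := S.coact_twist m
  coact_coact := S.coact_coact m
  coact_counit := S.coact_counit m
  compat h := S.compat h m

/-- Compatibility of a linear map with the data of Hom-Yetter-Drinfeld structures. -/
structure IsHom (D : HomYetterDrinfeldData k H M) (E : HomYetterDrinfeldData k H N)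
    (f : M →ₗ[k] N) : Prop where
  map_twist : ∀ m, f (D.twist m) = E.twist (f m)
  map_act : ∀ (h : H) (m), f (D.act h m) = E.act h (f m)
  map_coact : ∀ m, E.coact (f m) = f.rTensor H (D.coact m)

namespace AxiomsAt

variable {𝓗 : MonoidalHomHopfAlgebra k H} {D : HomYetterDrinfeldData k H M}
  {E : HomYetterDrinfeldData k H N}

/-- With `add` and `smul`: every axiom is linear in `m`, so the elements satisfying all of them form
a submodule. On a colimit it is then enough to check the images of the canonical maps. -/
theorem zero : D.AxiomsAt 𝓗 0 where
  twist_act a := by simp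
  act_act a b := by simp
  one_act := by simp
  coact_twist := by simp
  coact_coact := by simp
  coact_counit := by simp
  compat h := by simp

theorem add {m n : M} (hm : D.AxiomsAt 𝓗 m) (hn : D.AxiomsAt 𝓗 n) : D.AxiomsAt 𝓗 (m + n) where
  twist_act a := by simp only [map_add, hm.twist_act, hn.twist_act]
  act_act a b := by simp only [map_add, hm.act_act, hn.act_act]
  one_act := by simp only [map_add, hm.one_act, hn.one_act]
  coact_twist := by simp only [map_add, hm.coact_twist, hn.coact_twist]
  coact_coact := by simp only [map_add, hm.coact_coact, hn.coact_coact]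
  coact_counit := by simp only [map_add, hm.coact_counit, hn.coact_counit]
  compat h := by
    simp only [map_add, TensorProduct.tmul_add, LinearMap.rTensor_add, LinearMap.add_apply,
      hm.compat, hn.compat]

theorem smul (r : k) {m : M} (hm : D.AxiomsAt 𝓗 m) : D.AxiomsAt 𝓗 (r • m) where
  twist_act a := by simp only [map_smul, hm.twist_act]
  act_act a b := by simp only [map_smul, hm.act_act]
  one_act := by simp only [map_smul, hm.one_act]
  coact_twist := by simp only [map_smul, hm.coact_twist]
  coact_coact := by simp only [map_smul, hm.coact_coact]
  coact_counit := by simp only [map_smul, hm.coact_counit]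
  compat h := by
    simp only [map_smul, TensorProduct.tmul_smul, LinearMap.rTensor_smul, LinearMap.smul_apply,
      hm.compat]

end AxiomsAt

/-! ### Transport of the axioms along compatible linear maps -/

namespace IsHom

variable {D : HomYetterDrinfeldData k H M} {E : HomYetterDrinfeldData k H N} {f : M →ₗ[k] N}

theorem map_twist_symm (hf : IsHom D E f) (m : M) : f (D.twist.symm m) = E.twist.symm (f m) := by
  rw [LinearEquiv.eq_symm_apply, ← hf.map_twist, LinearEquiv.apply_symm_apply]

/-- This and the lemmas up to `map_twist_assoc_coact_act` express naturality, in the module, of the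
two sides of each coaction axiom. Read in one direction they push an axiom forward along `f`; read
in the other they pull it back when `f` is injective. -/
theorem map_rTensor_twist (hf : IsHom D E f) {P : Type u} [AddCommGroup P] [Module k P]
    (γ : H →ₗ[k] P) (x : M ⊗[k] H) :
    TensorProduct.map E.twist.toLinearMap γ (f.rTensor H x) =
      f.rTensor P (TensorProduct.map D.twist.toLinearMap γ x) := by
  induction x with
  | zero => simp
  | add x y hx hy => simp only [map_add, hx, hy]
  | tmul m h => simp [hf.map_twist]

theorem map_rTensor_twist_symm (hf : IsHom D E f) {P : Type u} [AddCommGroup P] [Module k P]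
    (γ : H →ₗ[k] P) (x : M ⊗[k] H) :
    TensorProduct.map E.twist.symm.toLinearMap γ (f.rTensor H x) =
      f.rTensor P (TensorProduct.map D.twist.symm.toLinearMap γ x) := by
  induction x with
  | zero => simp
  | add x y hx hy => simp only [map_add, hx, hy]
  | tmul m h => simp [hf.map_twist_symm]

theorem assoc_rTensor_rTensor (f : M →ₗ[k] N) (x : (M ⊗[k] H) ⊗[k] H) :
    TensorProduct.assoc k N H H ((f.rTensor H).rTensor H x) =
      f.rTensor (H ⊗[k] H) (TensorProduct.assoc k M H H x) := by
  rw [LinearMap.rTensor_tensor]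
  simp

theorem assoc_map_coact (hf : IsHom D E f) (γ : H →ₗ[k] H) (x : M ⊗[k] H) :
    TensorProduct.assoc k N H H (TensorProduct.map E.coact γ (f.rTensor H x)) =
      f.rTensor (H ⊗[k] H) (TensorProduct.assoc k M H H (TensorProduct.map D.coact γ x)) := by
  rw [← assoc_rTensor_rTensor]
  congr 1
  induction x with
  | zero => simp
  | add x y hx hy => simp only [map_add, hx, hy]
  | tmul m h => simp [hf.map_coact]

theorem rid_lTensor_rTensor (f : M →ₗ[k] N) (ε : H →ₗ[k] k) (x : M ⊗[k] H) :
    TensorProduct.rid k N (ε.lTensor N (f.rTensor H x)) =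
      f (TensorProduct.rid k M (ε.lTensor M x)) := by
  induction x with
  | zero => simp
  | add x y hx hy => simp only [map_add, hx, hy]
  | tmul m h => simp

theorem map_act_tensorTensorTensorComm (hf : IsHom D E f) (μ : H →ₗ[k] H →ₗ[k] H)
    (y : H ⊗[k] H) (x : M ⊗[k] H) :
    TensorProduct.map (TensorProduct.lift E.act) (TensorProduct.lift μ)
        (TensorProduct.tensorTensorTensorComm k H H N H (y ⊗ₜ[k] f.rTensor H x)) =
      f.rTensor H (TensorProduct.map (TensorProduct.lift D.act) (TensorProduct.lift μ)
        (TensorProduct.tensorTensorTensorComm k H H M H (y ⊗ₜ[k] x))) := by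
  induction x with
  | zero => simp
  | add x x' hx hx' => simp only [map_add, TensorProduct.tmul_add, hx, hx']
  | tmul m h =>
    induction y with
    | zero => simp
    | add y y' hy hy' => simp only [map_add, TensorProduct.add_tmul, hy, hy']
    | tmul a b => simp [hf.map_act]

theorem map_twist_assoc_coact_act (hf : IsHom D E f) (μ : H →ₗ[k] H →ₗ[k] H)
    (y : H ⊗[k] H) (m : M) :
    TensorProduct.map E.twist.toLinearMap (TensorProduct.lift μ)
        (TensorProduct.assoc k N H H
          (E.coact.rTensor H ((E.act.flip (E.twist.symm (f m))).rTensor H y))) =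
      f.rTensor H (TensorProduct.map D.twist.toLinearMap (TensorProduct.lift μ)
        (TensorProduct.assoc k M H H
          (D.coact.rTensor H ((D.act.flip (D.twist.symm m)).rTensor H y)))) := by
  induction y with
  | zero => simp
  | add y y' hy hy' => simp only [map_add, hy, hy']
  | tmul a b =>
    simp only [LinearMap.rTensor_tmul, LinearMap.flip_apply, ← hf.map_twist_symm, ← hf.map_act,
      hf.map_coact]
    -- Both sides now depend on the coaction only through one element of `M ⊗ H`, so pure tensors
    -- suffice.
    generalize D.coact _ = x
    induction x with
    | zero => simp
    | add x y hx hy => simp only [map_add, TensorProduct.add_tmul, hx, hy]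
    | tmul m h => simp [hf.map_twist]

/-- Over a flat `H`, compatible linear maps factor through injective ones compatibly. -/
theorem of_comp_injective [Module.Flat k H] {P : Type u} [AddCommGroup P] [Module k P]
    {C : HomYetterDrinfeldData k H P} (hf : IsHom D E f) (hinj : Function.Injective f)
    {g : P →ₗ[k] M} (hg : IsHom C E (f ∘ₗ g)) : IsHom C D g where
  map_twist p := hinj ((hg.map_twist p).trans (hf.map_twist (g p)).symm)
  map_act h p := hinj ((hg.map_act h p).trans (hf.map_act h (g p)).symm)
  map_coact p := Module.Flat.rTensor_preserves_injective_linearMap f hinj (by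
    rw [← hf.map_coact, ← LinearMap.comp_apply (f.rTensor H), ← LinearMap.rTensor_comp]
    exact hg.map_coact p)

/-- Compatible linear maps preserve the Hom-Yetter-Drinfeld axioms. -/
theorem axiomsAt_map {𝓗 : MonoidalHomHopfAlgebra k H} (hf : IsHom D E f) {m : M}
    (h : D.AxiomsAt 𝓗 m) : E.AxiomsAt 𝓗 (f m) where
  twist_act a := by simp only [← hf.map_twist, ← hf.map_act, h.twist_act]
  act_act a b := by simp only [← hf.map_twist, ← hf.map_act, h.act_act]
  one_act := by simp only [← hf.map_twist, ← hf.map_act, h.one_act]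
  coact_twist := by
    rw [← hf.map_twist, hf.map_coact, hf.map_coact, h.coact_twist, hf.map_rTensor_twist]
  coact_coact := by
    rw [hf.map_coact, hf.assoc_map_coact, hf.map_rTensor_twist_symm, h.coact_coact]
  coact_counit := by
    rw [hf.map_coact, rid_lTensor_rTensor, h.coact_counit, hf.map_twist_symm]
  compat a := by
    rw [hf.map_coact, hf.map_act_tensorTensorTensorComm, h.compat, hf.map_twist_assoc_coact_act]

/-- Over a flat `H`, injective compatible linear maps reflect the Hom-Yetter-Drinfeld axioms. -/
theorem axiomsAt_of_injective [Module.Flat k H] {𝓗 : MonoidalHomHopfAlgebra k H}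
    (hf : IsHom D E f) (hinj : Function.Injective f) {m : M} (h : E.AxiomsAt 𝓗 (f m)) :
    D.AxiomsAt 𝓗 m where
  twist_act a := hinj (by simp only [hf.map_twist, hf.map_act, h.twist_act])
  act_act a b := hinj (by simp only [hf.map_twist, hf.map_act, h.act_act])
  one_act := hinj (by simp only [hf.map_twist, hf.map_act, h.one_act])
  coact_twist := Module.Flat.rTensor_preserves_injective_linearMap f hinj (by
    rw [← hf.map_coact, hf.map_twist, h.coact_twist, hf.map_coact, hf.map_rTensor_twist])
  -- This comparison takes place in `M ⊗ (H ⊗ H)`, so the flatness needed is that of `H ⊗ H`,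
  -- inherited from `H`.
  coact_coact := Module.Flat.rTensor_preserves_injective_linearMap f hinj (by
    rw [← hf.assoc_map_coact, ← hf.map_rTensor_twist_symm, ← hf.map_coact, h.coact_coact])
  coact_counit := hinj (by
    rw [← rid_lTensor_rTensor, ← hf.map_coact, h.coact_counit, hf.map_twist_symm])
  compat a := Module.Flat.rTensor_preserves_injective_linearMap f hinj (by
    rw [← hf.map_act_tensorTensorTensorComm, ← hf.map_coact, h.compat,
      ← hf.map_twist_assoc_coact_act])

end IsHom

end HomYetterDrinfeldData

section Lift

variable {k M N P : Type u} [CommRing k] [AddCommGroup M] [Module k M]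
  [AddCommGroup N] [Module k N] [AddCommGroup P] [Module k P]

/-- The factorization of a linear map through an injective linear map whose range contains its
values. -/
noncomputable def LinearMap.factorThruInjective (i : N →ₗ[k] M) (hi : Function.Injective i)
    (g : P →ₗ[k] M) (hg : ∀ x, g x ∈ LinearMap.range i) : P →ₗ[k] N :=
  (LinearEquiv.ofInjective i hi).symm.toLinearMap ∘ₗ g.codRestrict (LinearMap.range i) hg

@[simp]
theorem LinearMap.apply_factorThruInjective (i : N →ₗ[k] M) (hi : Function.Injective i)
    (g : P →ₗ[k] M) (hg : ∀ x, g x ∈ LinearMap.range i) (x : P) :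
    i (LinearMap.factorThruInjective i hi g hg x) = g x := by
  have := LinearEquiv.apply_symm_apply (LinearEquiv.ofInjective i hi)
    (g.codRestrict (LinearMap.range i) hg x)
  exact congrArg Subtype.val this

end Lift

namespace HomYetterDrinfeldModule

open HomYetterDrinfeldData

/-! ### Restriction to stable submodules -/

section Restrict

variable {k H : Type u} [CommRing k] [AddCommGroup H] [Module k H]
  {𝓗 : MonoidalHomHopfAlgebra k H}

/-- The data underlying a Hom-Yetter-Drinfeld module. -/
def data (M : HomYetterDrinfeldModule 𝓗) : HomYetterDrinfeldData k H M.carrier :=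
  ofStructure M.str

theorem Hom.isHom {M N : HomYetterDrinfeldModule 𝓗} (f : Hom M N) :
    IsHom M.data N.data f.toLinearMap where
  map_twist := f.map_twist
  map_act := f.map_act
  map_coact := f.map_coact

theorem Hom.map_twist_symm {M N : HomYetterDrinfeldModule 𝓗} (f : Hom M N) (m : M.carrier) :
    f.toLinearMap (M.str.twist.symm m) = N.str.twist.symm (f.toLinearMap m) :=
  f.isHom.map_twist_symm m

/-- The module with data `D` satisfying the axioms. -/
@[simps]
def ofData {N : Type u} [AddCommGroup N] [Module k N] (D : HomYetterDrinfeldData k H N)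
    (hD : ∀ n, D.AxiomsAt 𝓗 n) : HomYetterDrinfeldModule 𝓗 where
  carrier := N
  str := D.toStructure hD

/-- A linear map compatible with the underlying data is a morphism. -/
@[simps]
def Hom.ofIsHom {M N : HomYetterDrinfeldModule 𝓗} (f : M.carrier →ₗ[k] N.carrier)
    (hf : IsHom M.data N.data f) : Hom M N where
  toLinearMap := f
  map_twist := hf.map_twist
  map_act := hf.map_act
  map_coact := hf.map_coact

/-- Closure of the range of a linear map into a Hom-Yetter-Drinfeld module under the structure. -/
structure IsStableRange (M : HomYetterDrinfeldModule 𝓗) {N : Type u} [AddCommGroup N] [Module k N]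
    (i : N →ₗ[k] M.carrier) : Prop where
  twist_mem : ∀ n, M.str.twist (i n) ∈ LinearMap.range i
  twist_symm_mem : ∀ n, M.str.twist.symm (i n) ∈ LinearMap.range i
  act_mem : ∀ h n, M.str.act h (i n) ∈ LinearMap.range i
  coact_mem : ∀ n, M.str.coact (i n) ∈ LinearMap.range (i.rTensor H)

variable [Module.Flat k H] (M : HomYetterDrinfeldModule 𝓗) {N : Type u} [AddCommGroup N]
  [Module k N] (i : N →ₗ[k] M.carrier) (hi : Function.Injective i) (hs : M.IsStableRange i)

/-- The restriction of the data of a Hom-Yetter-Drinfeld module along an injective linear map with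
stable range. -/
noncomputable def restrictData : HomYetterDrinfeldData k H N where
  twist := LinearEquiv.ofLinearMap
    (LinearMap.factorThruInjective i hi (M.str.twist.toLinearMap ∘ₗ i) hs.twist_mem)
    (LinearMap.factorThruInjective i hi (M.str.twist.symm.toLinearMap ∘ₗ i) hs.twist_symm_mem)
    (LinearMap.ext fun n => hi (by simp)) (LinearMap.ext fun n => hi (by simp))
  act := LinearMap.mk₂ k
    (fun h n => LinearMap.factorThruInjective i hi (M.str.act h ∘ₗ i) (hs.act_mem h) n)
    (fun _ _ _ => hi (by simp)) (fun _ _ _ => hi (by simp)) (fun _ _ _ => hi (by simp))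
    (fun _ _ _ => hi (by simp))
  -- By flatness `i ⊗ H` is injective, so the coaction has a unique lift to `N ⊗ H`.
  coact := LinearMap.factorThruInjective (i.rTensor H)
    (Module.Flat.rTensor_preserves_injective_linearMap i hi) (M.str.coact ∘ₗ i) hs.coact_mem

theorem isHom_restrictData : IsHom (M.restrictData i hi hs) M.data i where
  map_twist n := by simp [restrictData, data, ofStructure]
  map_act h n := by simp [restrictData, data, ofStructure]
  map_coact n := by simp [restrictData, data, ofStructure]

/-- The restriction of a Hom-Yetter-Drinfeld module along an injective linear map with stable
range. -/
noncomputable def restrict : HomYetterDrinfeldModule 𝓗 :=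
  ofData (M.restrictData i hi hs) fun n =>
    (M.isHom_restrictData i hi hs).axiomsAt_of_injective hi (axiomsAt_ofStructure M.str (i n))

/-- The inclusion of a restriction. -/
noncomputable def restrictHom : M.restrict i hi hs ⟶ M :=
  Hom.ofIsHom (M := M.restrict i hi hs) i (M.isHom_restrictData i hi hs)

end Restrict

/-! ### Preadditive structure and the forgetful functor -/

section Preadditive

variable {k H : Type u} [CommRing k] [AddCommGroup H] [Module k H]
  {𝓗 : MonoidalHomHopfAlgebra k H} {L M N : HomYetterDrinfeldModule 𝓗}

theorem hom_ext {f g : M ⟶ N} (h : f.toLinearMap = g.toLinearMap) : f = g := Hom.ext h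

instance : Zero (Hom M N) where
  zero := ⟨0, by simp, by simp, by simp⟩

instance : Add (Hom M N) where
  add f g :=
    { toLinearMap := f.toLinearMap + g.toLinearMap
      map_twist := fun m => by simp [f.map_twist, g.map_twist]
      map_act := fun h m => by simp [f.map_act, g.map_act]
      map_coact := fun m => by simp [f.map_coact, g.map_coact, LinearMap.rTensor_add] }

instance : Neg (Hom M N) where
  neg f :=
    { toLinearMap := -f.toLinearMap
      map_twist := fun m => by simp [f.map_twist]
      map_act := fun h m => by simp [f.map_act]
      map_coact := fun m => by simp [f.map_coact, LinearMap.rTensor_neg] }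

@[simp]
theorem zero_toLinearMap : (0 : Hom M N).toLinearMap = 0 := rfl

@[simp]
theorem add_toLinearMap (f g : Hom M N) :
    (f + g).toLinearMap = f.toLinearMap + g.toLinearMap := rfl

@[simp]
theorem neg_toLinearMap (f : Hom M N) : (-f).toLinearMap = -f.toLinearMap := rfl

instance : AddCommGroup (Hom M N) where
  add_assoc f g h := Hom.ext (by simp [add_assoc])
  zero_add f := Hom.ext (by simp)
  add_zero f := Hom.ext (by simp)
  neg_add_cancel f := Hom.ext (by simp)
  add_comm f g := Hom.ext (by simp [add_comm])
  nsmul := nsmulRec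
  zsmul := zsmulRec

instance : Preadditive (HomYetterDrinfeldModule 𝓗) where
  homGroup M N := inferInstanceAs (AddCommGroup (Hom M N))
  add_comp _ _ _ _ _ _ := Hom.ext (LinearMap.comp_add _ _ _)
  comp_add _ _ _ _ _ _ := Hom.ext (LinearMap.add_comp _ _ _)

variable (𝓗) in
/-- The forgetful functor to `k`-modules. -/
@[simps]
def forgetToModule : HomYetterDrinfeldModule 𝓗 ⥤ ModuleCat.{u} k where
  obj M := ModuleCat.of k M.carrier
  map f := ModuleCat.ofHom f.toLinearMap

instance : (forgetToModule 𝓗).Faithful where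
  map_injective h := Hom.ext (congrArg ModuleCat.Hom.hom h)

instance : (forgetToModule 𝓗).Additive where
  map_add := rfl

/-- The linear inverse of a bijective morphism is automatically a morphism; no flatness is needed.
-/
instance : (forgetToModule 𝓗).ReflectsIsomorphisms where
  reflects {M N} f hf := by
    let e : M.carrier ≃ₗ[k] N.carrier := (asIso ((forgetToModule 𝓗).map f)).toLinearEquiv
    have he : ∀ m, f.toLinearMap m = e m := fun m => rfl
    have hs : ∀ n, f.toLinearMap (e.symm n) = n := fun n => by simp [he]
    have hl : e.symm.toLinearMap ∘ₗ f.toLinearMap = LinearMap.id :=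
      LinearMap.ext fun m => by simp [he]
    let g : Hom N M :=
      { toLinearMap := e.symm.toLinearMap
        map_twist := fun n => e.injective (by
          simp only [LinearEquiv.coe_coe, ← he, f.map_twist, hs])
        map_act := fun h n => e.injective (by
          simp only [LinearEquiv.coe_coe, ← he, f.map_act, hs])
        map_coact := fun n => by
          -- Writing `n = f (e⁻¹ n)` turns the right-hand side into `(e⁻¹ ⊗ H) ∘ (f ⊗ H)` applied to
          -- the coaction of `e⁻¹ n`, and that composite is the identity.
          conv_rhs => rw [← hs n, f.map_coact, ← LinearMap.comp_apply, ← LinearMap.rTensor_comp,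
            hl, LinearMap.rTensor_id]
          rfl }
    exact ⟨g, hom_ext hl, hom_ext (LinearMap.ext hs)⟩

end Preadditive

/-! ### Kernels -/

section Kernel

open Limits

variable {k H : Type u} [CommRing k] [AddCommGroup H] [Module k H] [Module.Flat k H]
  {𝓗 : MonoidalHomHopfAlgebra k H} {M N : HomYetterDrinfeldModule 𝓗} (f : M ⟶ N)

theorem isStableRange_ker : M.IsStableRange (LinearMap.ker f.toLinearMap).subtype where
  twist_mem n := by simp [f.map_twist]
  twist_symm_mem n := by simp [f.map_twist_symm]
  act_mem h n := by simp [f.map_act]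
  coact_mem n := by
    -- Flatness identifies the kernel of `f ⊗ H` with the image of `ker f ⊗ H`. The coaction of `n`
    -- lies in that kernel because `f` is colinear.
    have h := Module.Flat.rTensor_exact H
      (LinearMap.exact_subtype_ker_map f.toLinearMap)
    exact (h _).1 (by rw [← f.map_coact]; simp)

/-- The kernel of a morphism of Hom-Yetter-Drinfeld modules. -/
noncomputable def kernelFork : KernelFork f :=
  KernelFork.ofι (M.restrictHom _ (Submodule.subtype_injective _) (isStableRange_ker f))
    (hom_ext (LinearMap.comp_ker_subtype _))

/-- `kernelFork f` is a kernel of `f`. -/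
noncomputable def kernelForkIsLimit : IsLimit (kernelFork f) :=
  KernelFork.IsLimit.ofι _ (hom_ext (LinearMap.comp_ker_subtype _))
    (fun g hg => Hom.ofIsHom (N := M.restrict _ _ (isStableRange_ker f))
      (g.toLinearMap.codRestrict _ fun x => LinearMap.congr_fun (congrArg Hom.toLinearMap hg) x)
      ((M.isHom_restrictData _ _ (isStableRange_ker f)).of_comp_injective
        (Submodule.subtype_injective _) g.isHom))
    (fun _ _ => rfl)
    (fun _ _ _ hm => hom_ext (LinearMap.ext fun x =>
      Subtype.ext (LinearMap.congr_fun (congrArg Hom.toLinearMap hm) x)))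

instance : HasKernels (HomYetterDrinfeldModule 𝓗) where
  has_limit f := ⟨_, kernelForkIsLimit f⟩

instance : PreservesLimit (parallelPair f 0) (forgetToModule 𝓗) :=
  preservesLimit_of_preserves_limit_cone (kernelForkIsLimit f)
    ((KernelFork.isLimitMapConeEquiv (kernelFork f) (forgetToModule 𝓗)).symm
      (ModuleCat.isLimitKernelFork _ ((forgetToModule 𝓗).map f)
        (LinearMap.exact_subtype_ker_map f.toLinearMap) (Submodule.subtype_injective _)))

end Kernel

end HomYetterDrinfeldModule

namespace HomYetterDrinfeldModule

open HomYetterDrinfeldData Limits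

/-! ### Colimits -/

section Colimit

variable {k H : Type u} [CommRing k] [AddCommGroup H] [Module k H]
  {𝓗 : MonoidalHomHopfAlgebra k H} {J : Type u} [Category.{u} J]
  (F : J ⥤ HomYetterDrinfeldModule 𝓗) {P : Type u} [AddCommGroup P] [Module k P]

/-- The colimit of the underlying modules of a diagram of Hom-Yetter-Drinfeld modules. -/
def ColimitCarrier : Type u :=
  (colimit (F ⋙ forgetToModule 𝓗) : ModuleCat.{u} k)

noncomputable instance : AddCommGroup (ColimitCarrier F) :=
  inferInstanceAs (AddCommGroup (colimit (F ⋙ forgetToModule 𝓗) : ModuleCat.{u} k))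

noncomputable instance : Module k (ColimitCarrier F) :=
  inferInstanceAs (Module k (colimit (F ⋙ forgetToModule 𝓗) : ModuleCat.{u} k))

/-- The canonical linear map to the colimit of the underlying modules. -/
noncomputable def colimitι (j : J) : (F.obj j).carrier →ₗ[k] ColimitCarrier F :=
  (colimit.ι (F ⋙ forgetToModule 𝓗) j).hom

theorem colimitι_comp_map {i j : J} (a : i ⟶ j) :
    colimitι F j ∘ₗ (F.map a).toLinearMap = colimitι F i :=
  congrArg ModuleCat.Hom.hom (colimit.w (F ⋙ forgetToModule 𝓗) a)

@[simp]
theorem colimitι_map {i j : J} (a : i ⟶ j) (x : (F.obj i).carrier) :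
    colimitι F j ((F.map a).toLinearMap x) = colimitι F i x :=
  LinearMap.congr_fun (colimitι_comp_map F a) x

/-- The linear map out of a colimit given by a compatible family of linear maps. -/
noncomputable def colimitLift (φ : ∀ j, (F.obj j).carrier →ₗ[k] P)
    (hφ : ∀ i j (a : i ⟶ j) (x), φ j ((F.map a).toLinearMap x) = φ i x) :
    ColimitCarrier F →ₗ[k] P :=
  (colimit.desc (F ⋙ forgetToModule 𝓗)
    { pt := ModuleCat.of k P
      ι := { app := fun j => ModuleCat.ofHom (φ j)
             naturality := fun _ _ a => ModuleCat.hom_ext (LinearMap.ext (hφ _ _ a)) } }).hom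

@[simp]
theorem colimitLift_ι (φ : ∀ j, (F.obj j).carrier →ₗ[k] P)
    (hφ : ∀ i j (a : i ⟶ j) (x), φ j ((F.map a).toLinearMap x) = φ i x) (j : J)
    (x : (F.obj j).carrier) : colimitLift F φ hφ (colimitι F j x) = φ j x :=
  LinearMap.congr_fun (congrArg ModuleCat.Hom.hom (colimit.ι_desc
    ({ pt := ModuleCat.of k P
       ι := { app := fun j => ModuleCat.ofHom (φ j)
              naturality := fun _ _ a => ModuleCat.hom_ext (LinearMap.ext (hφ _ _ a)) } } :
      Cocone (F ⋙ forgetToModule 𝓗)) j)) x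

variable {F} in
theorem colimitCarrier_hom_ext {f g : ColimitCarrier F →ₗ[k] P}
    (h : ∀ j x, f (colimitι F j x) = g (colimitι F j x)) : f = g := by
  have : ModuleCat.ofHom f = ModuleCat.ofHom g :=
    colimit.hom_ext fun j => ModuleCat.hom_ext (LinearMap.ext (h j))
  exact congrArg ModuleCat.Hom.hom this

variable {F} in
theorem mem_of_colimitι_mem {S : Submodule k (ColimitCarrier F)} (h : ∀ j x, colimitι F j x ∈ S)
    (y : ColimitCarrier F) : y ∈ S := by
  -- The quotient map by `S` vanishes on every `colimitι`, hence is zero.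
  have := colimitCarrier_hom_ext (f := S.mkQ) (g := 0) fun j x => by simpa using h j x
  simpa using LinearMap.congr_fun this y

/-- The Hom-Yetter-Drinfeld data on the colimit of the underlying modules. -/
noncomputable def colimitData : HomYetterDrinfeldData k H (ColimitCarrier F) where
  twist := LinearEquiv.ofLinearMap
    (colimitLift F (fun j => colimitι F j ∘ₗ (F.obj j).str.twist.toLinearMap)
      fun i j a x => by simp [← (F.map a).map_twist])
    (colimitLift F (fun j => colimitι F j ∘ₗ (F.obj j).str.twist.symm.toLinearMap)
      fun i j a x => by simp [← (F.map a).map_twist_symm])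
    (colimitCarrier_hom_ext fun j x => by simp)
    (colimitCarrier_hom_ext fun j x => by simp)
  act := (colimitLift F (fun j => ((F.obj j).str.act.compr₂ (colimitι F j)).flip)
    fun i j a x => LinearMap.ext fun h => by simp [← (F.map a).map_act]).flip
  coact := colimitLift F (fun j => (colimitι F j).rTensor H ∘ₗ (F.obj j).str.coact)
    fun i j a x => by
      rw [LinearMap.comp_apply, (F.map a).map_coact, ← LinearMap.comp_apply,
        ← LinearMap.rTensor_comp, colimitι_comp_map, LinearMap.comp_apply]

theorem isHom_colimitι (j : J) : IsHom (F.obj j).data (colimitData F) (colimitι F j) where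
  map_twist m := by simp [colimitData, data, ofStructure]
  map_act h m := by simp [colimitData, data, ofStructure]
  map_coact m := by simp [colimitData, data, ofStructure]

theorem axiomsAt_colimitData (y : ColimitCarrier F) : (colimitData F).AxiomsAt 𝓗 y :=
  mem_of_colimitι_mem
    (S := { carrier := {y | (colimitData F).AxiomsAt 𝓗 y}
            add_mem' := AxiomsAt.add
            zero_mem' := AxiomsAt.zero
            smul_mem' := fun r _ h => h.smul r })
    (fun j x => (isHom_colimitι F j).axiomsAt_map (axiomsAt_ofStructure (F.obj j).str x)) y

/-- The colimit cocone of a diagram of Hom-Yetter-Drinfeld modules. -/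
noncomputable def colimitCocone : Cocone F where
  pt := ofData (colimitData F) (axiomsAt_colimitData F)
  ι :=
    { app := fun j => Hom.ofIsHom (N := ofData (colimitData F) (axiomsAt_colimitData F)) _
        (isHom_colimitι F j)
      naturality := fun _ _ a => hom_ext (colimitι_comp_map F a) }

/-- The underlying linear map of the morphism out of the colimit induced by a cocone. -/
noncomputable def colimitDesc (s : Cocone F) : ColimitCarrier F →ₗ[k] s.pt.carrier :=
  colimitLift F (fun j => (s.ι.app j).toLinearMap)
    fun _ _ a => LinearMap.congr_fun (congrArg Hom.toLinearMap (s.w a))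

theorem colimitDesc_ι (s : Cocone F) (j : J) (x : (F.obj j).carrier) :
    colimitDesc F s (colimitι F j x) = (s.ι.app j).toLinearMap x :=
  colimitLift_ι F _ (fun _ _ a => LinearMap.congr_fun (congrArg Hom.toLinearMap (s.w a))) j x

theorem colimitDesc_comp_ι (s : Cocone F) (j : J) :
    colimitDesc F s ∘ₗ colimitι F j = (s.ι.app j).toLinearMap :=
  LinearMap.ext (colimitDesc_ι F s j)

/-- Each condition is an equality of linear maps out of the colimit, so it can be tested after
composing with `colimitι`, where it is the corresponding condition for a leg of `s`. -/
theorem isHom_colimitDesc (s : Cocone F) :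
    IsHom (colimitData F) s.pt.data (colimitDesc F s) where
  map_twist := LinearMap.congr_fun (f := colimitDesc F s ∘ₗ (colimitData F).twist.toLinearMap)
    (g := s.pt.data.twist.toLinearMap ∘ₗ colimitDesc F s)
    (colimitCarrier_hom_ext fun j x => by
      simp only [LinearMap.comp_apply, LinearEquiv.coe_coe, ← (isHom_colimitι F j).map_twist,
        colimitDesc_ι]
      exact (s.ι.app j).isHom.map_twist x)
  map_act h := LinearMap.congr_fun (f := colimitDesc F s ∘ₗ (colimitData F).act h)
    (g := s.pt.data.act h ∘ₗ colimitDesc F s)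
    (colimitCarrier_hom_ext fun j x => by
      simp only [LinearMap.comp_apply, ← (isHom_colimitι F j).map_act, colimitDesc_ι]
      exact (s.ι.app j).isHom.map_act h x)
  map_coact := LinearMap.congr_fun (f := s.pt.data.coact ∘ₗ colimitDesc F s)
    (g := (colimitDesc F s).rTensor H ∘ₗ (colimitData F).coact)
    (colimitCarrier_hom_ext fun j x => by
      rw [LinearMap.comp_apply, LinearMap.comp_apply, (isHom_colimitι F j).map_coact,
        ← LinearMap.comp_apply (LinearMap.rTensor H _), ← LinearMap.rTensor_comp,
        colimitDesc_comp_ι, colimitDesc_ι]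
      exact (s.ι.app j).isHom.map_coact x)

/-- `colimitCocone F` is a colimit. -/
noncomputable def colimitCoconeIsColimit : IsColimit (colimitCocone F) where
  desc s := Hom.ofIsHom (M := ofData (colimitData F) (axiomsAt_colimitData F))
    (colimitDesc F s) (isHom_colimitDesc F s)
  fac s j := hom_ext (colimitDesc_comp_ι F s j)
  uniq s _ hm := hom_ext (colimitCarrier_hom_ext fun j x =>
    (LinearMap.congr_fun (congrArg Hom.toLinearMap (hm j)) x).trans (colimitDesc_ι F s j x).symm)

instance : HasColimitsOfSize.{u, u} (HomYetterDrinfeldModule 𝓗) where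
  has_colimits_of_shape _ _ := { has_colimit := fun F => ⟨_, colimitCoconeIsColimit F⟩ }

instance : PreservesColimitsOfSize.{u, u} (forgetToModule 𝓗) where
  preservesColimitsOfShape := {
    preservesColimit := fun {F} =>
      preservesColimit_of_preserves_colimit_cocone (colimitCoconeIsColimit F)
        (IsColimit.ofIsoColimit (colimit.isColimit (F ⋙ forgetToModule 𝓗))
          (Cocone.ext (Iso.refl _) fun _ => rfl)) }

end Colimit

end HomYetterDrinfeldModule

namespace HomYetterDrinfeldModule

open HomYetterDrinfeldData Limits

/-! ### Abelian structure and exactness of filtered colimits -/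

section Abelian

variable {k H : Type u} [CommRing k] [AddCommGroup H] [Module k H]
  {𝓗 : MonoidalHomHopfAlgebra k H}

instance : HasFiniteColimits (HomYetterDrinfeldModule 𝓗) :=
  hasFiniteColimits_of_hasColimitsOfSize.{u, u} _

instance : HasFiniteBiproducts (HomYetterDrinfeldModule 𝓗) :=
  HasFiniteBiproducts.of_hasFiniteCoproducts

instance : PreservesFiniteColimits (forgetToModule 𝓗) :=
  PreservesColimitsOfSize.preservesFiniteColimits.{u, u} _

variable [Module.Flat k H]

/-- The forgetful functor preserves kernels and cokernels, so it sends this comparison to the one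
for `k`-modules, up to isomorphisms at both ends; it then reflects invertibility. -/
instance {M N : HomYetterDrinfeldModule 𝓗} (f : M ⟶ N) :
    IsIso (Abelian.coimageImageComparison f) :=
  have := IsIso.of_isIso_fac_right
    (Abelian.PreservesCoimage.hom_coimageImageComparison (forgetToModule 𝓗) f).symm
  isIso_of_reflects_iso _ (forgetToModule 𝓗)

noncomputable instance : Abelian (HomYetterDrinfeldModule 𝓗) :=
  Abelian.ofCoimageImageComparisonIsIso

instance : PreservesFiniteLimits (forgetToModule 𝓗) :=
  (forgetToModule 𝓗).preservesFiniteLimits_of_preservesKernels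

instance : AB5OfSize.{u, u} (HomYetterDrinfeldModule 𝓗) where
  ofShape J _ _ :=
    HasExactColimitsOfShape.domain_of_functor J (forgetToModule 𝓗)

end Abelian

/-! ### A separator -/

section Separator

variable (k H : Type u)

/-- Formal expressions in one variable for the elements of a Hom-Yetter-Drinfeld submodule generated
by one element; `component n t` stands for the `n`-th member of a chosen countable family spanning
the left tensor components of the coaction on `t`. -/
inductive GeneratorTerm : Type u
  | var : GeneratorTerm
  | zero : GeneratorTerm
  | add : GeneratorTerm → GeneratorTerm → GeneratorTerm
  | smul : k → GeneratorTerm → GeneratorTerm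
  | act : H → GeneratorTerm → GeneratorTerm
  | twist : GeneratorTerm → GeneratorTerm
  | twistSymm : GeneratorTerm → GeneratorTerm
  | component : ℕ → GeneratorTerm → GeneratorTerm

variable {k H} [CommRing k] [AddCommGroup H] [Module k H]

/-- A tensor comes from `M' ⊗ H` with `M'` finitely generated, and `c` enumerates generators of
`M'`. The family is fixed before `S`, so it can serve as an operation in formal terms. -/
theorem _root_.TensorProduct.exists_nat_family_mem_range_rTensor {M : Type u} [AddCommGroup M]
    [Module k M] (t : M ⊗[k] H) :
    ∃ c : ℕ → M, ∀ S : Submodule k M, (∀ n, c n ∈ S) →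
      t ∈ LinearMap.range (S.subtype.rTensor H) := by
  obtain ⟨M', hfin, hM'⟩ :=
    TensorProduct.exists_finite_submodule_left_of_setFinite {t} (Set.finite_singleton t)
  obtain ⟨s, hs⟩ := (Module.Finite.iff_fg.1 hfin)
  -- Inserting `0` makes the set nonempty, as an enumeration by `ℕ` requires.
  obtain ⟨c, hc⟩ := (s.finite_toSet.insert 0).countable.exists_eq_range (Set.insert_nonempty _ _)
  refine ⟨c, fun S hS => ?_⟩
  have hle : M' ≤ S := by
    rw [← hs, Submodule.span_le]
    intro x hx
    have : x ∈ Set.range c := hc ▸ Set.mem_insert_of_mem 0 hx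
    obtain ⟨n, rfl⟩ := this
    exact hS n
  obtain ⟨y, hy⟩ := hM' rfl
  refine ⟨(Submodule.inclusion hle).rTensor H y, ?_⟩
  rw [← LinearMap.comp_apply, ← LinearMap.rTensor_comp, Submodule.subtype_comp_inclusion, hy]

variable {𝓗 : MonoidalHomHopfAlgebra k H} (M : HomYetterDrinfeldModule 𝓗)

/-- A countable family spanning the left tensor components of the coaction on `m`. -/
noncomputable def coactComponent (m : M.carrier) : ℕ → M.carrier :=
  (TensorProduct.exists_nat_family_mem_range_rTensor (M.str.coact m)).choose

variable {M} in
theorem coact_mem_range_rTensor {m : M.carrier} {S : Submodule k M.carrier}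
    (hS : ∀ n, M.coactComponent m n ∈ S) :
    M.str.coact m ∈ LinearMap.range (S.subtype.rTensor H) :=
  (TensorProduct.exists_nat_family_mem_range_rTensor (M.str.coact m)).choose_spec S hS

/-- The value of a formal expression at an element of a Hom-Yetter-Drinfeld module. -/
noncomputable def interpret (x : M.carrier) : GeneratorTerm k H → M.carrier
  | .var => x
  | .zero => 0
  | .add s t => interpret x s + interpret x t
  | .smul r t => r • interpret x t
  | .act h t => M.str.act h (interpret x t)
  | .twist t => M.str.twist (interpret x t)
  | .twistSymm t => M.str.twist.symm (interpret x t)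
  | .component n t => M.coactComponent (interpret x t) n

/-- The submodule of values of formal expressions at `x`. -/
noncomputable def generatedSubmodule (x : M.carrier) : Submodule k M.carrier where
  carrier := Set.range (M.interpret x)
  add_mem' := by
    rintro _ _ ⟨s, rfl⟩ ⟨t, rfl⟩
    exact ⟨.add s t, rfl⟩
  zero_mem' := ⟨.zero, rfl⟩
  smul_mem' := by
    rintro r _ ⟨t, rfl⟩
    exact ⟨.smul r t, rfl⟩

/-- Closure is built into the terms: each operation is a constructor, and the coaction of a value
lies in the right range because its components are again values. -/
theorem isStableRange_generatedSubmodule (x : M.carrier) :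
    M.IsStableRange (M.generatedSubmodule x).subtype where
  twist_mem := by
    rintro ⟨_, t, rfl⟩
    rw [Submodule.range_subtype]
    exact ⟨.twist t, rfl⟩
  twist_symm_mem := by
    rintro ⟨_, t, rfl⟩
    rw [Submodule.range_subtype]
    exact ⟨.twistSymm t, rfl⟩
  act_mem := by
    rintro h ⟨_, t, rfl⟩
    rw [Submodule.range_subtype]
    exact ⟨.act h t, rfl⟩
  coact_mem := by
    rintro ⟨_, t, rfl⟩
    exact coact_mem_range_rTensor fun n => ⟨.component n t, rfl⟩

variable {M} in
/-- Stability of the range is invariant under reparametrization. -/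
theorem IsStableRange.comp_linearEquiv {N N' : Type u} [AddCommGroup N] [Module k N]
    [AddCommGroup N'] [Module k N'] {i : N →ₗ[k] M.carrier} (hi : M.IsStableRange i)
    (e : N' ≃ₗ[k] N) : M.IsStableRange (i ∘ₗ e.toLinearMap) := by
  have hr : LinearMap.range (i ∘ₗ e.toLinearMap) = LinearMap.range i :=
    LinearMap.range_comp_of_range_eq_top _ e.range
  have hr' : LinearMap.range ((i ∘ₗ e.toLinearMap).rTensor H) = LinearMap.range (i.rTensor H) := by
    rw [LinearMap.rTensor_comp]
    exact LinearMap.range_comp_of_range_eq_top _ (e.rTensor H).range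
  exact
    { twist_mem := fun n => hr ▸ hi.twist_mem (e n)
      twist_symm_mem := fun n => hr ▸ hi.twist_symm_mem (e n)
      act_mem := fun h n => hr ▸ hi.act_mem h (e n)
      coact_mem := fun n => hr' ▸ hi.coact_mem (e n) }

variable (𝓗) in
/-- Indices for the Hom-Yetter-Drinfeld modules carried by quotients of the type of formal
expressions. -/
structure GeneratorIndex : Type u where
  rel : Setoid (GeneratorTerm k H)
  [addCommGroup : AddCommGroup (Quotient rel)]
  [module : Module k (Quotient rel)]
  str : HomYetterDrinfeldStructure 𝓗 (Quotient rel)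

attribute [instance] GeneratorIndex.addCommGroup GeneratorIndex.module

/-- The Hom-Yetter-Drinfeld module with a given index. -/
def generator (i : GeneratorIndex 𝓗) : HomYetterDrinfeldModule 𝓗 where
  carrier := Quotient i.rel
  str := i.str

/-- The submodule generated by `x` is in bijection with the terms modulo equality of values at `x`.
Transporting the structure along this bijection puts the subobject on a quotient of the fixed type
of terms, with `x` the class of `var`. -/
theorem exists_generator_hom [Module.Flat k H] (x : M.carrier) :
    ∃ (i : GeneratorIndex 𝓗) (f : generator i ⟶ M) (y : (generator i).carrier),
      f.toLinearMap y = x := by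
  let e : Quotient (Setoid.ker (M.interpret x)) ≃ M.generatedSubmodule x :=
    Setoid.quotientKerEquivRange (M.interpret x)
  let instGroup := e.addCommGroup
  let instModule := e.module k
  let i := (M.generatedSubmodule x).subtype ∘ₗ (e.linearEquiv k).toLinearMap
  have hi : Function.Injective i :=
    (Submodule.subtype_injective _).comp (e.linearEquiv k).injective
  have hs := (M.isStableRange_generatedSubmodule x).comp_linearEquiv (e.linearEquiv k)
  exact ⟨@GeneratorIndex.mk k H _ _ _ 𝓗 _ instGroup instModule (M.restrict i hi hs).str,
    M.restrictHom i hi hs, Quotient.mk _ .var, rfl⟩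

/-- Every element is hit by a morphism from some generator, so morphisms that agree after all such
precompositions agree at every element. -/
theorem isSeparating_generator [Module.Flat k H] :
    ObjectProperty.IsSeparating (.ofObj (generator (𝓗 := 𝓗))) := by
  intro M N f g h
  refine hom_ext (LinearMap.ext fun x => ?_)
  obtain ⟨i, p, y, rfl⟩ := M.exists_generator_hom x
  exact LinearMap.congr_fun (congrArg Hom.toLinearMap (h _ ⟨i⟩ p)) y

instance [Module.Flat k H] : HasSeparator (HomYetterDrinfeldModule 𝓗) :=
  ⟨_, (isSeparating_generator (𝓗 := 𝓗)).isSeparator_coproduct⟩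

instance [Module.Flat k H] : IsGrothendieckAbelian.{u} (HomYetterDrinfeldModule 𝓗) where

end Separator

end HomYetterDrinfeldModule

theorem corollary4p5 {k H : Type u} [CommRing k] [AddCommGroup H] [Module k H] [Module.Flat k H]
    (𝓗 : MonoidalHomHopfAlgebra k H) (hS : Function.Bijective 𝓗.antipode) :
    ∃ _ : Abelian (HomYetterDrinfeldModule 𝓗),
      IsGrothendieckAbelian.{u} (HomYetterDrinfeldModule 𝓗) ∧
        EnoughInjectives (HomYetterDrinfeldModule 𝓗) :=
  ⟨inferInstance, inferInstance, IsGrothendieckAbelian.enoughInjectives.{u}⟩
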